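/- Let $(R,\mathfrak m)$ be a Noetherian Cohen--Macaulay local ring of Krull dimension $d$. A finitely generated $R$-module $M$ is called (maximal) Cohen--Macaulay if $M=0$ or $\operatorname{depth} M=d$, and it is called Ulrich if moreover $e(M)=\mu(M)$, where $e(M)=\lim_{n\to\infty} \frac{d!}{n^d}\,\ell_R(M/\mathfrak m^nM)$ is the multiplicity of $M$ and $\mu(M)$ is its minimal number of generators. For a finitely generated $R$-module $N$, the first syzygy $\Omega N$ is the kernel of a minimal free cover of $N$, that is, of a surjection $R^{n}\to N$ with kernel contained in $\mathfrak mR^{n}$; it is unique up to isomorphism. Let $Q$ be a parameter ideal of $R$ (an ideal generated by a system of parameters of $R$) such that $\mathfrak m^2=Q\mathfrak m$, and let $M$ be an Ulrich $R$-module. Then for every $R$-regular element $a\in Q$, the syzygy $\Omega(M/aM)$ is also an Ulrich $R$-module. -/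

import Mathlib

open IsLocalRing Filter Topology

namespace Ulrich

universe u v w

section

variable (R : Type u) [CommRing R]

/-- The Krull dimension of `R` as a natural number. It is the true dimension whenever
`R` is a (nonzero) ring of finite dimension, in particular for every Noetherian local ring. -/
noncomputable def dim : ℕ := ((ringKrullDim R).unbotD 0).toNat

/-- `μ(M)`, the minimal number of generators of a finitely generated module. -/
noncomputable def mu (M : Type v) [AddCommGroup M] [Module R M] : ℕ :=
  (⊤ : Submodule R M).spanFinrank

variable [IsLocalRing R]

/-- The depth of a module over a local ring: the supremum of the lengths of the `M`-regular
sequences contained in the maximal ideal. -/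
noncomputable def depth (M : Type v) [AddCommGroup M] [Module R M] : ℕ∞ :=
  ⨆ rs : {rs : List R // (∀ r ∈ rs, r ∈ maximalIdeal R) ∧ RingTheory.Sequence.IsRegular M rs},
    (rs.1.length : ℕ∞)

/-- (Maximal) Cohen--Macaulay modules: finitely generated modules which are zero or whose depth
is the dimension of the ring. -/
structure IsCohenMacaulay (M : Type v) [AddCommGroup M] [Module R M] : Prop where
  finite : Module.Finite R M
  depth_eq : Subsingleton M ∨ ((depth R M : ℕ∞) : WithBot ℕ∞) = ringKrullDim R

/-- `HasMultiplicity R M e` says that `e` is the multiplicity of `M` (with respect to the maximal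
ideal `𝔪`), i.e. `e = lim_{n → ∞} d! ℓ(M / 𝔪ⁿ M) / n ^ d`, where `d = dim R`. -/
def HasMultiplicity (M : Type v) [AddCommGroup M] [Module R M] (e : ℝ) : Prop :=
  Tendsto
    (fun n : ℕ => ((dim R).factorial : ℝ) *
      ((Module.length R (M ⧸ ((maximalIdeal R) ^ n • (⊤ : Submodule R M)))).toNat : ℝ) /
        (n : ℝ) ^ dim R)
    atTop (𝓝 e)

/-- Ulrich modules: Cohen--Macaulay modules `M` with `e(M) = μ(M)`. -/
structure IsUlrich (M : Type v) [AddCommGroup M] [Module R M] : Prop where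
  isCohenMacaulay : IsCohenMacaulay R M
  hasMultiplicity : HasMultiplicity R M (mu R M)

/-- Parameter ideals: ideals generated by a system of parameters, that is, by `d = dim R` elements
generating an ideal primary to the maximal ideal. -/
def IsParameterIdeal (Q : Ideal R) : Prop :=
  ∃ x : Fin (dim R) → R, Q = Ideal.span (Set.range x) ∧ Q.radical = maximalIdeal R

/-- `IsFirstSyzygy R Z N` says that `Z` is (isomorphic to) the first syzygy of `N`: there is an
exact sequence `0 → Z → Rⁿ → N → 0` which is minimal, i.e. the image of `Z` lies in `𝔪 Rⁿ`. -/
def IsFirstSyzygy (Z : Type w) [AddCommGroup Z] [Module R Z]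
    (N : Type v) [AddCommGroup N] [Module R N] : Prop :=
  ∃ (n : ℕ) (i : Z →ₗ[R] (Fin n → R)) (p : (Fin n → R) →ₗ[R] N),
    Function.Injective i ∧ Function.Exact i p ∧ Function.Surjective p ∧
      LinearMap.range i ≤ maximalIdeal R • (⊤ : Submodule R (Fin n → R))

/-- Every finitely generated module over a local ring has a first syzygy. -/
theorem exists_isFirstSyzygy (N : Type v) [AddCommGroup N] [Module R N] [Module.Finite R N] :
    ∃ (n : ℕ) (Z : Submodule R (Fin n → R)), IsFirstSyzygy R Z N := by
  classical
  have hex : ∃ n : ℕ, ∃ g : Fin n → N, Submodule.span R (Set.range g) = ⊤ :=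
    Module.Finite.exists_fin
  let n := Nat.find hex
  obtain ⟨g, hg⟩ : ∃ g : Fin n → N, Submodule.span R (Set.range g) = ⊤ := Nat.find_spec hex
  have hmin : ∀ m, m < n → ¬ ∃ g : Fin m → N, Submodule.span R (Set.range g) = ⊤ :=
    fun m hm => Nat.find_min hex hm
  clear_value n
  let p : (Fin n → R) →ₗ[R] N := Fintype.linearCombination R g
  refine ⟨n, LinearMap.ker p, n, (LinearMap.ker p).subtype, p, Subtype.val_injective, ?_, ?_, ?_⟩
  · rw [LinearMap.exact_iff, Submodule.range_subtype]
  · rw [← LinearMap.range_eq_top, Fintype.range_linearCombination, hg]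
  · rw [Submodule.range_subtype]
    intro c hc
    have hci : ∀ i, c i ∈ maximalIdeal R := by
      intro i
      by_contra hi
      have hu : IsUnit (c i) := by simpa using hi
      obtain ⟨u, hu⟩ := hu
      cases n with
      | zero => exact i.elim0
      | succ m =>
        refine hmin m (Nat.lt_succ_self m) ⟨fun j => g (i.succAbove j), ?_⟩
        rw [eq_top_iff, ← hg, Submodule.span_le]
        have hother : ∀ j, g (i.succAbove j) ∈
            Submodule.span R (Set.range fun j => g (i.succAbove j)) :=
          fun j => Submodule.subset_span ⟨j, rfl⟩
        rintro _ ⟨k, rfl⟩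
        rcases Fin.eq_self_or_eq_succAbove i k with rfl | ⟨j, rfl⟩
        · have h0 : c k • g k + ∑ j, c (k.succAbove j) • g (k.succAbove j) = 0 := by
            have : p c = 0 := hc
            rwa [Fintype.linearCombination_apply, Fin.sum_univ_succAbove _ k] at this
          have h1 : g k = (↑u⁻¹ : R) • (-∑ j, c (k.succAbove j) • g (k.succAbove j)) := by
            rw [← eq_neg_of_add_eq_zero_left h0, ← hu, smul_smul, Units.inv_mul, one_smul]
          rw [SetLike.mem_coe, h1]
          exact Submodule.smul_mem _ _ (Submodule.neg_mem _
            (Submodule.sum_mem _ fun j _ => Submodule.smul_mem _ _ (hother j)))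
        · exact hother j
    rw [pi_eq_sum_univ' c]
    exact Submodule.sum_mem _ fun i _ =>
      Submodule.smul_mem_smul (hci i) Submodule.mem_top

end

end Ulrich

/-! Since `𝔪ⁿ⁺¹ = Qⁿ𝔪`, the `𝔪`-adic and `Q`-adic filtrations interleave with bounded shift, so a
Cohen–Macaulay `N` has `e(N) = ℓ(N/QN)` (`hasMultiplicity_length_quotient`). As `μ(N) = ℓ(N/𝔪N)`,
such an `N` is Ulrich iff `𝔪N = QN` (`IsUlrich.smul_top_eq`, `isUlrich_of_smul_top_eq`).

By Nakayama the minimal cover `F → M/aM` lifts to a surjection `P : F → M`, and the syzygy becomes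
`Z = P⁻¹(aM) = ker P + aF`. It is Cohen–Macaulay as an extension of `aM ≅ M` by `ker P`
(`isWeaklyRegular_comap_smul_top`).

By minimality `ker P ⊆ 𝔪F`, so `𝔪 ker P ⊆ 𝔪²F ∩ ker P ⊆ QF ∩ ker P`. This last module lies in `Q ker
P` because `Q` is generated by an `M`-regular sequence (`smul_top_inf_ker_le`). Together with `𝔪M =
QM` and `a ∈ Q` this gives `𝔪Z = QZ` (`smul_comap_smul_top_le`). -/

namespace Ulrich

universe u v w

open RingTheory.Sequence Pointwise

/-! ### Depth, associated primes and systems of parameters -/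

section Depth

variable {R : Type u} [CommRing R] [IsNoetherianRing R]

/-- An associated prime `p` of `N` lies in an associated prime of `N / x N` containing `x`. -/
lemma exists_isAssociatedPrime_quotSMulTop [IsLocalRing R] {N : Type v} [AddCommGroup N]
    [Module R N] [Module.Finite R N] {x : R} (hx : x ∈ maximalIdeal R) (reg : IsSMulRegular N x)
    {p : Ideal R} (hp : IsAssociatedPrime p N) :
    ∃ q : Ideal R, IsAssociatedPrime q (QuotSMulTop x N) ∧ p ≤ q ∧ x ∈ q := by
  obtain ⟨hpp, n₀, hn₀⟩ := isAssociatedPrime_iff.mp hp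
  -- Let `U` be the elements killed by `p`. If `U ⊆ xN`, then `U = xU` by regularity of `x`, so `U =
  -- 0` by Nakayama, although `n₀ ∈ U` is nonzero.
  have hU : ∃ u : N, (∀ r ∈ p, r • u = 0) ∧ u ∉ x • (⊤ : Submodule R N) := by
    by_contra! hcon
    let U : Submodule R N := Submodule.torsionBySet R N p
    have hUx : U ≤ maximalIdeal R • U := by
      intro u hu
      have hu' : ∀ r ∈ p, r • u = 0 := fun r hr =>
        (Submodule.mem_torsionBySet_iff _ _).mp hu ⟨r, hr⟩
      obtain ⟨n, -, rfl⟩ := Submodule.mem_smul_pointwise_iff_exists _ _ _ |>.mp (hcon u hu')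
      refine Submodule.smul_mem_smul hx ?_
      refine (Submodule.mem_torsionBySet_iff _ _).mpr ?_
      rintro ⟨r, hr⟩
      refine reg.right_eq_zero_of_smul ?_
      change x • r • n = 0
      rw [smul_comm]
      exact hu' r hr
    have hbot : U = ⊥ := Submodule.eq_bot_of_le_smul_of_le_jacobson_bot _ U
      (IsNoetherian.noetherian U) hUx (maximalIdeal_le_jacobson _)
    have hmem : n₀ ∈ U := by
      refine (Submodule.mem_torsionBySet_iff _ _).mpr ?_
      rintro ⟨r, hr⟩
      have hr' : r ∈ p := hr
      rw [hn₀] at hr'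
      simpa [Submodule.mem_colon_singleton] using hr'
    rw [hbot, Submodule.mem_bot] at hmem
    apply hpp.ne_top
    rw [hn₀, hmem]
    simp
  obtain ⟨u, hu, hux⟩ := hU
  have hne : (Submodule.Quotient.mk u : QuotSMulTop x N) ≠ 0 := by
    rwa [Ne, Submodule.Quotient.mk_eq_zero]
  obtain ⟨q, hq, hle⟩ := exists_le_isAssociatedPrime_of_isNoetherianRing R _ hne
  refine ⟨q, hq, fun r hr => hle ?_, ?_⟩
  · rw [Submodule.mem_colon_singleton, ← Submodule.Quotient.mk_smul, hu r hr]
    simp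
  · apply hq.annihilator_le
    rw [Submodule.annihilator_top]
    exact QuotSMulTop.mem_annihilator _ x

/-- The length of a regular sequence on `N` is at most `dim R / p` for `p` an associated prime. -/
lemma length_le_ringKrullDim_quotient_of_isAssociatedPrime [IsLocalRing R] {rs : List R} :
    ∀ {N : Type v} [AddCommGroup N] [Module R N] [Module.Finite R N]
      (_ : ∀ r ∈ rs, r ∈ maximalIdeal R) (_ : IsWeaklyRegular N rs)
      {p : Ideal R} (_ : IsAssociatedPrime p N), (rs.length : WithBot ℕ∞) ≤ ringKrullDim (R ⧸ p) := by
  induction rs with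
  | nil =>
    intro N _ _ _ _ _ p hp
    have := hp.isPrime
    simpa using ringKrullDim_nonneg_of_nontrivial
  | cons x rs ih =>
    intro N _ _ _ hm h p hp
    obtain ⟨hx, hrs⟩ := (isWeaklyRegular_cons_iff _ _ _).mp h
    obtain ⟨q, hq, hpq, hxq⟩ := exists_isAssociatedPrime_quotSMulTop (hm x (by simp)) hx hp
    have hpp := hp.isPrime
    have hxp : x ∉ p := by
      intro hxp
      have : x ∈ ⋃ p ∈ associatedPrimes R N, (p : Set R) :=
        Set.mem_iUnion₂.mpr ⟨p, hp, hxp⟩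
      rw [biUnion_associatedPrimes_eq_compl_regular] at this
      exact this hx
    have h1 := ih (fun r hr => hm r (by simp [hr])) hrs hq
    -- `x` lies in `q` but not in `p`, so each regular element costs one dimension.
    have h2 : ringKrullDim (R ⧸ q) + 1 ≤ ringKrullDim (R ⧸ p) := by
      refine ringKrullDim_succ_le_of_surjective (Ideal.Quotient.factor hpq)
        (Ideal.Quotient.factor_surjective hpq) (r := Ideal.Quotient.mk p x) ?_ ?_
      · rw [mem_nonZeroDivisors_iff_ne_zero, Ne, Ideal.Quotient.eq_zero_iff_mem]
        exact hxp
      · rw [Ideal.Quotient.factor_mk, Ideal.Quotient.eq_zero_iff_mem]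
        exact hxq
    refine le_trans ?_ h2
    rw [List.length_cons, Nat.cast_add, Nat.cast_one]
    gcongr

open CategoryTheory Abelian in
/-- Dividing out a regular element lowers the depth by at most one. -/
lemma exists_isRegular_quotSMulTop [Small.{v} R] [IsLocalRing R] (N : Type v) [AddCommGroup N]
    [Module R N] [Module.Finite R N] [Nontrivial N] {y : R} (hy : y ∈ maximalIdeal R)
    (reg : IsSMulRegular N y) {n : ℕ}
    (h : ∃ rs : List R, rs.length = n + 1 ∧ (∀ r ∈ rs, r ∈ maximalIdeal R) ∧ IsRegular N rs) :
    ∃ rs : List R, rs.length = n ∧ (∀ r ∈ rs, r ∈ maximalIdeal R) ∧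
      IsRegular (QuotSMulTop y N) rs := by
  have hlt (L : Type v) [AddCommGroup L] [Module R L] [Module.Finite R L] [Nontrivial L] :
      maximalIdeal R • (⊤ : Submodule R L) < ⊤ :=
    (Submodule.top_ne_ideal_smul_of_le_jacobson_annihilator
      (maximalIdeal_le_jacobson _)).symm.lt_top
  have := nontrivial_quotSMulTop_of_mem_maximalIdeal N hy
  -- Rees: regular sequences of length `n` exist iff `Extⁱ(R/𝔪, -)` vanishes for `i < n`. The long
  -- exact sequence of multiplication by `y` then loses one degree.
  have h1 := (((ModuleCat.of R N).exists_isRegular_tfae (maximalIdeal R) (n + 1)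
    (hlt N)).out 1 3).mpr h
  refine (((ModuleCat.of R (QuotSMulTop y N)).exists_isRegular_tfae (maximalIdeal R) n
    (hlt _)).out 1 3).mp fun i hi => ?_
  have zero1 := AddCommGrpCat.isZero_of_iff_subsingleton.mpr (h1 i (by omega))
  have zero2 := AddCommGrpCat.isZero_of_iff_subsingleton.mpr (h1 (i + 1) (by omega))
  exact AddCommGrpCat.subsingleton_of_isZero <| ShortComplex.Exact.isZero_of_both_zeros
    ((Ext.covariant_sequence_exact₃' _ (IsSMulRegular.smulShortComplex_shortExact
      (M := ModuleCat.of R N) reg)) i (i + 1) rfl)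
    (zero1.eq_zero_of_src _) (zero2.eq_zero_of_tgt _)

/-- If `xs` generates the maximal ideal up to radical modulo a prime `p`, then
`dim R / p` is at most the length of `xs`. -/
lemma ringKrullDim_quotient_le_length [IsLocalRing R] {p : Ideal R} [p.IsPrime] {xs : List R}
    (hxs : ∀ x ∈ xs, x ∈ maximalIdeal R)
    (h : ∀ q : Ideal R, q.IsPrime → p ≤ q → (∀ x ∈ xs, x ∈ q) → q = maximalIdeal R) :
    ringKrullDim (R ⧸ p) ≤ xs.length := by
  classical
  have : IsLocalRing (R ⧸ p) := .of_surjective' _ Ideal.Quotient.mk_surjective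
  rw [← IsLocalRing.maximalIdeal_height_eq_ringKrullDim]
  let s : Finset (R ⧸ p) := (xs.map (Ideal.Quotient.mk p)).toFinset
  have hcomap {J : Ideal (R ⧸ p)} (hJ : J.IsPrime) (hs : Ideal.span (s : Set (R ⧸ p)) ≤ J) :
      J.comap (Ideal.Quotient.mk p) = maximalIdeal R := by
    refine h _ inferInstance (fun r hr => ?_) fun x hx => ?_
    · simp [Ideal.mem_comap, Ideal.Quotient.eq_zero_iff_mem.mpr hr]
    · exact hs (Ideal.subset_span (by simp only [s, List.coe_toFinset]; simpa using ⟨x, hx, rfl⟩))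
  have hmem : maximalIdeal (R ⧸ p) ∈ (Ideal.span (s : Set (R ⧸ p))).minimalPrimes := by
    have hle : Ideal.span (s : Set (R ⧸ p)) ≤ maximalIdeal (R ⧸ p) := by
      rw [Ideal.span_le]
      intro y hy
      obtain ⟨x, hx, rfl⟩ : ∃ x ∈ xs, Ideal.Quotient.mk p x = y := by simpa [s] using hy
      have hmax : (maximalIdeal (R ⧸ p)).comap (Ideal.Quotient.mk p) = maximalIdeal R :=
        eq_maximalIdeal (Ideal.comap_isMaximal_of_surjective _ Ideal.Quotient.mk_surjective)
      have hx' := hxs x hx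
      rwa [← hmax, Ideal.mem_comap] at hx'
    refine ⟨⟨inferInstance, hle⟩, fun J ⟨hJ, hsJ⟩ _ => ?_⟩
    have h1 := hcomap hJ hsJ
    have h2 := hcomap inferInstance (hle)
    rw [← h1] at h2
    exact (Ideal.comap_injective_of_surjective _ Ideal.Quotient.mk_surjective h2).le
  refine (WithBot.coe_le_coe.mpr
    (Ideal.height_le_card_of_mem_minimalPrimes_span_finset hmem)).trans ?_
  have : s.card ≤ xs.length := (List.toFinset_card_le _).trans (by simp)
  exact_mod_cast this

/-- Every system of parameters is a regular sequence on a maximal Cohen--Macaulay module, in the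
form of an induction on the length of the sequence. -/
lemma isWeaklyRegular_of_isRegular_of_small [Small.{v} R] [IsLocalRing R] {xs : List R} :
    ∀ {N : Type v} [AddCommGroup N] [Module R N] [Module.Finite R N] [Nontrivial N]
      (_ : ∀ x ∈ xs, x ∈ maximalIdeal R)
      (_ : ∀ q : Ideal R, q.IsPrime → Module.annihilator R N ≤ q → (∀ x ∈ xs, x ∈ q) →
        q = maximalIdeal R)
      (_ : ∃ rs : List R, rs.length = xs.length ∧ (∀ r ∈ rs, r ∈ maximalIdeal R) ∧
        IsRegular N rs), IsWeaklyRegular N xs := by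
  induction xs with
  | nil => intros; exact .nil _ _
  | cons x xs ih =>
    intro N _ _ _ _ hxs hq hrs
    have hxm : x ∈ maximalIdeal R := hxs x (by simp)
    have hxs' : ∀ x ∈ xs, x ∈ maximalIdeal R := fun x hx => hxs x (by simp [hx])
    have hreg : IsSMulRegular N x := by
      -- A zero divisor `x` lies in an associated prime `p`. Then `xs` alone cuts `R/p` down to
      -- dimension zero, while the regular sequence forces `dim R/p ≥ xs.length + 1`.
      by_contra hcon
      have hmem : x ∈ ⋃ p ∈ associatedPrimes R N, (p : Set R) := by
        rw [biUnion_associatedPrimes_eq_compl_regular]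
        exact hcon
      obtain ⟨p, hp, hxp⟩ := Set.mem_iUnion₂.mp hmem
      have hp : IsAssociatedPrime p N := hp
      have := hp.isPrime
      obtain ⟨rs, hlen, hrm, hrs⟩ := hrs
      have h1 := length_le_ringKrullDim_quotient_of_isAssociatedPrime hrm hrs.toIsWeaklyRegular hp
      have hann := hp.annihilator_le
      rw [Submodule.annihilator_top] at hann
      have h2 : ringKrullDim (R ⧸ p) ≤ xs.length :=
        ringKrullDim_quotient_le_length hxs' fun q hqp hpq hxq =>
          hq q hqp (hann.trans hpq) fun z hz => by
            rcases List.mem_cons.mp hz with rfl | hz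
            exacts [hpq hxp, hxq z hz]
      have h3 := h1.trans h2
      rw [hlen, List.length_cons] at h3
      have h4 : xs.length + 1 ≤ xs.length := by exact_mod_cast h3
      omega
    have := nontrivial_quotSMulTop_of_mem_maximalIdeal N hxm
    refine .cons hreg (ih hxs' (fun q hqp hann hxq => hq q hqp ?_ fun z hz => ?_)
      (exists_isRegular_quotSMulTop N hxm hreg hrs))
    · exact (LinearMap.annihilator_le_of_surjective _
        (Submodule.mkQ_surjective (x • (⊤ : Submodule R N)))).trans hann
    · rcases List.mem_cons.mp hz with rfl | hz
      exacts [hann (QuotSMulTop.mem_annihilator _ _), hxq z hz]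

lemma isWeaklyRegular_of_subsingleton {S : Type*} [CommRing S] (N : Type v) [AddCommGroup N]
    [Module S N] [Subsingleton N] (rs : List S) : IsWeaklyRegular N rs :=
  ⟨fun _ _ => Function.injective_of_subsingleton _⟩

variable [IsLocalRing R]

lemma ringKrullDim_eq_dim : ringKrullDim R = dim R := by
  obtain ⟨n, hn⟩ : ∃ n : ℕ, ringKrullDim R = n := by
    have h1 : ringKrullDim R ≠ ⊤ := ringKrullDim_ne_top
    have h2 : ringKrullDim R ≠ ⊥ := ringKrullDim_ne_bot
    obtain ⟨k, hk⟩ := WithBot.ne_bot_iff_exists.mp h2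
    have hk' : k ≠ ⊤ := by
      rintro rfl
      exact h1 hk.symm
    obtain ⟨n, rfl⟩ := ENat.ne_top_iff_exists.mp hk'
    exact ⟨n, hk.symm⟩
  rw [dim, hn]
  rfl

/-- A nonzero Cohen--Macaulay module has a regular sequence of length `dim R`. -/
lemma IsCohenMacaulay.exists_isRegular {N : Type v} [AddCommGroup N] [Module R N] [Nontrivial N]
    (h : IsCohenMacaulay R N) :
    ∃ rs : List R, rs.length = dim R ∧ (∀ r ∈ rs, r ∈ maximalIdeal R) ∧ IsRegular N rs := by
  have hd := h.depth_eq.resolve_left (not_subsingleton N)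
  rw [ringKrullDim_eq_dim] at hd
  have hd' : depth R N = (dim R : ℕ∞) := by exact_mod_cast hd
  have : Nonempty {rs : List R // (∀ r ∈ rs, r ∈ maximalIdeal R) ∧ IsRegular N rs} :=
    ⟨⟨[], by simp, .nil _ _⟩⟩
  obtain ⟨⟨rs, hm, hr⟩, hlen⟩ := ENat.exists_eq_iSup_of_lt_top
    (f := fun rs : {rs : List R // (∀ r ∈ rs, r ∈ maximalIdeal R) ∧ IsRegular N rs} =>
      (rs.1.length : ℕ∞)) (by
        change depth R N < ⊤
        rw [hd']
        exact ENat.natCast_lt_top _)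
  refine ⟨rs, ?_, hm, hr⟩
  have h1 : (rs.length : ℕ∞) = depth R N := hlen
  rw [hd'] at h1
  exact_mod_cast h1

/-- A system of parameters is a regular sequence on every Cohen--Macaulay module. -/
lemma IsCohenMacaulay.isWeaklyRegular {N : Type v} [AddCommGroup N] [Module R N]
    (h : IsCohenMacaulay R N) {xs : List R} (hlen : xs.length = dim R)
    (hrad : (Ideal.ofList xs).radical = maximalIdeal R) : IsWeaklyRegular N xs := by
  rcases subsingleton_or_nontrivial N with _ | _
  · exact isWeaklyRegular_of_subsingleton N xs
  have := h.finite
  obtain ⟨rs, hrl, hrm, hr⟩ := h.exists_isRegular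
  -- The `Ext` argument needs `R` small in the universe of the module.
  let e : ULift.{u} N ≃ₗ[R] N := ULift.moduleEquiv
  have : Small.{max u v} R := small_max.{v} R
  have : Module.Finite R (ULift.{u} N) := .equiv e.symm
  rw [← e.isWeaklyRegular_congr]
  refine isWeaklyRegular_of_isRegular_of_small (fun x hx => ?_) (fun q hq _ hx => ?_)
    ⟨rs, hrl.trans hlen.symm, hrm, (e.isRegular_congr rs).mpr hr⟩
  · rw [← hrad]
    exact Ideal.le_radical (Ideal.subset_span hx)
  · have : maximalIdeal R ≤ q := by
      rw [← hrad, hq.isRadical.radical_le_iff]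
      exact Ideal.span_le.mpr hx
    exact ((maximalIdeal.isMaximal R).eq_of_le hq.ne_top this).symm

/-- An `R`-regular element is regular on every Cohen--Macaulay module. -/
lemma IsCohenMacaulay.isSMulRegular {N : Type v} [AddCommGroup N] [Module R N]
    (h : IsCohenMacaulay R N) {a : R} (ha : IsSMulRegular R a) : IsSMulRegular N a := by
  rcases subsingleton_or_nontrivial N with _ | _
  · exact Function.injective_of_subsingleton _
  have := h.finite
  obtain ⟨rs, hrl, hrm, hr⟩ := h.exists_isRegular
  by_contra hcon
  have hmem : a ∈ ⋃ p ∈ associatedPrimes R N, (p : Set R) := by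
    rw [biUnion_associatedPrimes_eq_compl_regular]
    exact hcon
  obtain ⟨p, hp, hap⟩ := Set.mem_iUnion₂.mp hmem
  have h1 := length_le_ringKrullDim_quotient_of_isAssociatedPrime hrm hr.toIsWeaklyRegular hp
  have ha' : a ∈ nonZeroDivisors R := by
    rw [mem_nonZeroDivisors_iff_right]
    intro x hx
    exact ha.right_eq_zero_of_smul (by rwa [smul_eq_mul, mul_comm])
  -- A nonzerodivisor in `p` gives `dim R/p < dim R`, against `h1`.
  have h2 := ringKrullDim_succ_le_of_surjective (Ideal.Quotient.mk p) Ideal.Quotient.mk_surjective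
    ha' (Ideal.Quotient.eq_zero_iff_mem.mpr hap)
  have h3 : ((dim R : ℕ) : WithBot ℕ∞) + 1 ≤ dim R := by
    refine le_trans ?_ (h2.trans ringKrullDim_eq_dim.le)
    rw [← hrl]
    gcongr
  have h4 : dim R + 1 ≤ dim R := by exact_mod_cast h3
  omega

/-- A finite module on which a sequence of length `dim R` in the maximal ideal is weakly regular
is Cohen--Macaulay. -/
lemma isCohenMacaulay_of_isWeaklyRegular {N : Type v} [AddCommGroup N] [Module R N]
    [Module.Finite R N] {xs : List R} (hlen : xs.length = dim R)
    (hxs : ∀ x ∈ xs, x ∈ maximalIdeal R) (h : IsWeaklyRegular N xs) : IsCohenMacaulay R N := by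
  refine ⟨inferInstance, ?_⟩
  rcases subsingleton_or_nontrivial N with hN | _
  · exact .inl hN
  refine .inr ?_
  rw [ringKrullDim_eq_dim]
  have hd : depth R N = (dim R : ℕ∞) := by
    refine le_antisymm (iSup_le fun ⟨rs, hm, hr⟩ => ?_) ?_
    · obtain ⟨p, hp⟩ := associatedPrimes.nonempty R N
      have h1 := (length_le_ringKrullDim_quotient_of_isAssociatedPrime hm hr.toIsWeaklyRegular
        hp).trans (ringKrullDim_quotient_le p)
      rw [ringKrullDim_eq_dim] at h1
      exact_mod_cast h1
    · rw [← hlen]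
      exact le_iSup (fun rs : {rs : List R // (∀ r ∈ rs, r ∈ maximalIdeal R) ∧ IsRegular N rs} =>
        (rs.1.length : ℕ∞)) ⟨xs, hxs, .of_isWeaklyRegular_of_mem_maximalIdeal N hxs h⟩
  rw [hd]
  rfl

end Depth

/-! ### Powers of an ideal generated by a regular sequence -/

section Powers

variable {R : Type u} [CommRing R]

/-- Products of generators either involve `x` or lie in `I ^ (k + 1)`. This splitting drives the
inductions on the length of the sequence. -/
lemma span_singleton_sup_pow_succ (x : R) (I : Ideal R) (k : ℕ) :
    (Ideal.span {x} ⊔ I) ^ (k + 1) =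
      Ideal.span {x} * (Ideal.span {x} ⊔ I) ^ k ⊔ I ^ (k + 1) := by
  set J := Ideal.span {x} ⊔ I with hJ
  have hI : I ≤ J := le_sup_right
  have hx : Ideal.span {x} ≤ J := le_sup_left
  induction k with
  | zero => simp [hJ]
  | succ k ih =>
    apply le_antisymm
    · rw [pow_succ' J (k + 1)]
      nth_rw 1 [hJ]
      rw [Ideal.sup_mul]
      refine sup_le le_sup_left ?_
      rw [ih, Ideal.mul_sup, ← pow_succ' I]
      refine sup_le (le_sup_of_le_left ?_) le_sup_right
      rw [mul_left_comm]
      refine Ideal.mul_mono_right ?_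
      rw [← ih, pow_succ']
      exact Ideal.mul_mono_left hI
    · refine sup_le ?_ (Ideal.pow_right_mono hI _)
      rw [pow_succ' J (k + 1)]
      exact Ideal.mul_mono_left hx

variable {N : Type v} [AddCommGroup N] [Module R N]

lemma mem_span_singleton_sup_pow_smul_top_iff {x : R} {I : Ideal R} {k : ℕ} {z : N} :
    z ∈ (Ideal.span {x} ⊔ I) ^ (k + 1) • (⊤ : Submodule R N) ↔
      ∃ w ∈ (Ideal.span {x} ⊔ I) ^ k • (⊤ : Submodule R N),
        ∃ v ∈ I ^ (k + 1) • (⊤ : Submodule R N), z = x • w + v := by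
  rw [span_singleton_sup_pow_succ, Submodule.sup_smul, Submodule.mul_smul,
    Submodule.ideal_span_singleton_smul, Submodule.mem_sup]
  constructor
  · rintro ⟨y, hy, v, hv, rfl⟩
    obtain ⟨w, hw, rfl⟩ := (Submodule.mem_smul_pointwise_iff_exists _ _ _).mp hy
    exact ⟨w, hw, v, hv, rfl⟩
  · rintro ⟨w, hw, v, hv, rfl⟩
    exact ⟨x • w, Submodule.smul_mem_pointwise_smul _ _ _ hw, v, hv, rfl⟩

lemma mem_of_smul_mem_span_singleton_sup_pow_succ_smul_top {x : R} {I : Ideal R} {k : ℕ}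
    (h : IsSMulRegular (N ⧸ I ^ (k + 1) • (⊤ : Submodule R N)) x) {z : N}
    (hz : x • z ∈ (Ideal.span {x} ⊔ I) ^ (k + 1) • (⊤ : Submodule R N)) :
    z ∈ (Ideal.span {x} ⊔ I) ^ k • (⊤ : Submodule R N) := by
  obtain ⟨w, hw, v, hv, hzw⟩ := mem_span_singleton_sup_pow_smul_top_iff.mp hz
  have h1 : z - w ∈ I ^ (k + 1) • (⊤ : Submodule R N) := by
    refine mem_of_isSMulRegular_quotient_of_smul_mem h ?_
    rwa [smul_sub, hzw, add_sub_cancel_left]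
  have h2 : I ^ (k + 1) • (⊤ : Submodule R N) ≤ (Ideal.span {x} ⊔ I) ^ k • ⊤ :=
    Submodule.smul_mono_left ((Ideal.pow_le_pow_right k.le_succ).trans
      (Ideal.pow_right_mono le_sup_right _))
  simpa using Submodule.add_mem _ (h2 h1) hw

lemma mk_mem_smul_top_quotSMulTop_iff {x : R} {I : Ideal R} {z : N} :
    (Submodule.Quotient.mk z : QuotSMulTop x N) ∈ I • (⊤ : Submodule R (QuotSMulTop x N)) ↔
      ∃ w : N, ∃ v ∈ I • (⊤ : Submodule R N), z = x • w + v := by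
  have h1 : I • (⊤ : Submodule R (QuotSMulTop x N)) =
      (I • (⊤ : Submodule R N)).map (Submodule.mkQ (x • (⊤ : Submodule R N))) := by
    rw [Submodule.map_smul'', Submodule.map_top, Submodule.range_mkQ]
  rw [h1, Submodule.mem_map]
  constructor
  · rintro ⟨v, hv, hvz⟩
    have h2 := (Submodule.Quotient.eq _).mp hvz.symm
    obtain ⟨w, -, hw⟩ := (Submodule.mem_smul_pointwise_iff_exists _ _ _).mp h2
    exact ⟨w, v, hv, by rw [hw]; abel⟩
  · rintro ⟨w, v, hv, rfl⟩
    refine ⟨v, hv, (Submodule.Quotient.eq _).mpr ?_⟩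
    rw [show v - (x • w + v) = x • (-w) by rw [smul_neg]; abel]
    exact Submodule.smul_mem_pointwise_smul _ _ _ trivial

lemma mk_mem_pow_smul_top_quotSMulTop {x : R} {I : Ideal R} {k : ℕ} {z : N}
    (hz : z ∈ (Ideal.span {x} ⊔ I) ^ (k + 1) • (⊤ : Submodule R N)) :
    (Submodule.Quotient.mk z : QuotSMulTop x N) ∈
      I ^ (k + 1) • (⊤ : Submodule R (QuotSMulTop x N)) := by
  obtain ⟨w, -, v, hv, rfl⟩ := mem_span_singleton_sup_pow_smul_top_iff.mp hz
  exact mk_mem_smul_top_quotSMulTop_iff.mpr ⟨w, v, hv, rfl⟩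

variable [IsNoetherianRing R] [IsLocalRing R]

/-- If `y, l` is a regular sequence on `N`, then `y` is regular modulo the powers of `(l)`. -/
lemma isSMulRegular_quotient_pow_smul_top {l : List R} :
    ∀ {N : Type v} [AddCommGroup N] [Module R N] [Module.Finite R N] {y : R}
      (_ : ∀ r ∈ y :: l, r ∈ maximalIdeal R) (_ : IsWeaklyRegular N (y :: l)) (k : ℕ),
      IsSMulRegular (N ⧸ Ideal.ofList l ^ k • (⊤ : Submodule R N)) y := by
  induction l with
  | nil =>
    intro N _ _ _ y _ h k
    rw [isSMulRegular_quotient_iff_mem_of_smul_mem]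
    intro z hz
    cases k with
    | zero => simp
    | succ k =>
      have hbot : Ideal.ofList ([] : List R) ^ (k + 1) • (⊤ : Submodule R N) = ⊥ := by
        rw [Ideal.ofList_nil, Ideal.bot_pow (Nat.succ_ne_zero k), Submodule.bot_smul]
      rw [hbot, Submodule.mem_bot] at hz ⊢
      exact ((isWeaklyRegular_cons_iff _ _ _).mp h).1.right_eq_zero_of_smul hz
  | cons x l ih =>
    intro N _ _ _ y hm h k
    -- Regular sequences in the maximal ideal may be permuted, so `y` can be moved to the end or
    -- behind `x`.
    have hxl : IsWeaklyRegular N (x :: l) :=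
      ((isWeaklyRegular_append_iff N (x :: l) [y]).mp
        (isWeaklyRegular_of_perm_of_subset_maximalIdeal h
          (List.perm_append_singleton y (x :: l)).symm hm)).1
    have hyl : IsWeaklyRegular (QuotSMulTop x N) (y :: l) :=
      ((isWeaklyRegular_cons_iff N x (y :: l)).mp
        (isWeaklyRegular_of_perm_of_subset_maximalIdeal h (List.Perm.swap _ _ _) hm)).2
    have hx := ih (fun r hr => hm r (List.mem_cons_of_mem _ hr)) hxl
    have hy := ih (fun r hr => hm r (by simp_all; tauto)) hyl
    rw [Ideal.ofList_cons]
    induction k with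
    | zero =>
      rw [isSMulRegular_quotient_iff_mem_of_smul_mem]
      simp
    | succ k ihk =>
      rw [isSMulRegular_quotient_iff_mem_of_smul_mem]
      intro z hz
      -- Cancelling `y` modulo `x` gives `z = xw + v` with `v` in `(l)ᵏ⁺¹N`. Then `yxw` lies in `(x,
      -- l)ᵏ⁺¹N`; cancelling `x` lowers the exponent to `k`, where `ihk` cancels `y`.
      have h1 : (Submodule.Quotient.mk z : QuotSMulTop x N) ∈
          Ideal.ofList l ^ (k + 1) • (⊤ : Submodule R (QuotSMulTop x N)) := by
        refine mem_of_isSMulRegular_quotient_of_smul_mem (hy (k + 1)) ?_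
        rw [← Submodule.Quotient.mk_smul]
        exact mk_mem_pow_smul_top_quotSMulTop hz
      obtain ⟨w, v, hv, rfl⟩ := mk_mem_smul_top_quotSMulTop_iff.mp h1
      refine mem_span_singleton_sup_pow_smul_top_iff.mpr ⟨w, ?_, v, hv, rfl⟩
      refine mem_of_isSMulRegular_quotient_of_smul_mem ihk ?_
      refine mem_of_smul_mem_span_singleton_sup_pow_succ_smul_top (hx (k + 1)) ?_
      have h2 : y • v ∈ (Ideal.span {x} ⊔ Ideal.ofList l) ^ (k + 1) • (⊤ : Submodule R N) :=
        Submodule.smul_mem _ _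
          (Submodule.smul_mono_left (Ideal.pow_right_mono le_sup_right _) hv)
      have h3 := Submodule.sub_mem _ hz h2
      rwa [smul_add, add_sub_cancel_right, smul_comm] at h3

/-- The recursion for the length of `N / (x, l)ᵏ N`. -/
lemma length_quotient_pow_succ_smul_top [Module.Finite R N] {x : R} {l : List R}
    (hm : ∀ r ∈ x :: l, r ∈ maximalIdeal R) (h : IsWeaklyRegular N (x :: l)) (k : ℕ) :
    Module.length R (N ⧸ Ideal.ofList (x :: l) ^ (k + 1) • (⊤ : Submodule R N)) =
      Module.length R (N ⧸ Ideal.ofList (x :: l) ^ k • (⊤ : Submodule R N)) +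
      Module.length R (QuotSMulTop x N ⧸
        Ideal.ofList l ^ (k + 1) • (⊤ : Submodule R (QuotSMulTop x N))) := by
  have hx := isSMulRegular_quotient_pow_smul_top hm h (k + 1)
  rw [Ideal.ofList_cons]
  -- With `J = (x, l)` and `N' = N/xN`, the sequence is `0 → N/JᵏN → N/Jᵏ⁺¹N → N'/(l)ᵏ⁺¹N' → 0`, the
  -- first map being multiplication by `x`.
  let f := Submodule.mapQ ((Ideal.span {x} ⊔ Ideal.ofList l) ^ k • (⊤ : Submodule R N))
    ((Ideal.span {x} ⊔ Ideal.ofList l) ^ (k + 1) • (⊤ : Submodule R N)) (LinearMap.lsmul R N x)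
    fun w hw => mem_span_singleton_sup_pow_smul_top_iff.mpr
      ⟨w, hw, 0, Submodule.zero_mem _, by simp⟩
  let g := Submodule.mapQ ((Ideal.span {x} ⊔ Ideal.ofList l) ^ (k + 1) • (⊤ : Submodule R N))
    (Ideal.ofList l ^ (k + 1) • (⊤ : Submodule R (QuotSMulTop x N)))
    (Submodule.mkQ (x • (⊤ : Submodule R N))) fun w hw => mk_mem_pow_smul_top_quotSMulTop hw
  refine Module.length_eq_add_of_exact f g ?_ ?_ ?_
  · rw [← LinearMap.ker_eq_bot, LinearMap.ker_eq_bot']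
    intro z hz
    obtain ⟨z, rfl⟩ := Submodule.Quotient.mk_surjective _ z
    rw [Submodule.Quotient.mk_eq_zero]
    refine mem_of_smul_mem_span_singleton_sup_pow_succ_smul_top hx ?_
    exact (Submodule.Quotient.mk_eq_zero _).mp hz
  · intro z
    obtain ⟨z, rfl⟩ := Submodule.Quotient.mk_surjective _ z
    obtain ⟨z, rfl⟩ := Submodule.Quotient.mk_surjective _ z
    exact ⟨Submodule.Quotient.mk z, rfl⟩
  · intro z
    obtain ⟨z, rfl⟩ := Submodule.Quotient.mk_surjective _ z
    constructor
    · intro hz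
      obtain ⟨w, v, hv, rfl⟩ := mk_mem_smul_top_quotSMulTop_iff.mp
        ((Submodule.Quotient.mk_eq_zero _).mp hz)
      refine ⟨Submodule.Quotient.mk w, (Submodule.Quotient.eq _).mpr ?_⟩
      rw [LinearMap.lsmul_apply, sub_add_cancel_left]
      exact Submodule.neg_mem _
        (Submodule.smul_mono_left (Ideal.pow_right_mono le_sup_right _) hv)
    · rintro ⟨w, hw⟩
      obtain ⟨w, rfl⟩ := Submodule.Quotient.mk_surjective _ w
      rw [← hw]
      refine (Submodule.Quotient.mk_eq_zero _).mpr
        (mk_mem_smul_top_quotSMulTop_iff.mpr ⟨w, 0, Submodule.zero_mem _, ?_⟩)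
      simp

/-- The Hilbert--Samuel function of an ideal generated by a regular sequence. -/
lemma length_quotient_pow_smul_top {l : List R} :
    ∀ {N : Type v} [AddCommGroup N] [Module R N] [Module.Finite R N]
      (_ : ∀ r ∈ l, r ∈ maximalIdeal R) (_ : IsWeaklyRegular N l) (k : ℕ),
      Module.length R (N ⧸ Ideal.ofList l ^ (k + 1) • (⊤ : Submodule R N)) =
        (k + l.length).choose l.length *
          Module.length R (N ⧸ Ideal.ofList l • (⊤ : Submodule R N)) := by
  induction l with
  | nil =>
    intro N _ _ _ _ _ k
    rw [Ideal.ofList_nil, Ideal.bot_pow (Nat.succ_ne_zero k)]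
    simp
  | cons x l ih =>
    intro N _ _ _ hm h k
    have hN := ih (fun r hr => hm r (List.mem_cons_of_mem _ hr))
      ((isWeaklyRegular_cons_iff _ _ _).mp h).2
    have he := (Submodule.quotOfListConsSMulTopEquivQuotSMulTopInner N x l).length_eq
    induction k with
    | zero =>
      rw [(Submodule.quotEquivOfEq (Ideal.ofList (x :: l) ^ (0 + 1) • (⊤ : Submodule R N))
        (Ideal.ofList (x :: l) • ⊤) (by rw [zero_add, pow_one])).length_eq]
      simp
    -- The recursion becomes Pascal's rule.
    | succ k ihk =>
      rw [length_quotient_pow_succ_smul_top hm h, ihk, hN, he, ← add_mul, List.length_cons,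
        show k + 1 + (l.length + 1) = (k + 1 + l.length) + 1 by ring, Nat.choose_succ_succ,
        add_comm ((_ : ℕ) : ℕ∞), Nat.cast_add, show k + (l.length + 1) = k + 1 + l.length by ring]

end Powers

/-! ### Multiplicity and the criterion `𝔪N = QN` -/

section Multiplicity

lemma tendsto_shift_div_pow (c : ℝ) (d : ℕ) :
    Tendsto (fun n : ℕ => ((n : ℝ) + c) ^ d / (n : ℝ) ^ d) atTop (𝓝 1) := by
  have h1 : Tendsto (fun n : ℕ => (1 + c / (n : ℝ)) ^ d) atTop (𝓝 ((1 + 0) ^ d)) :=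
    (tendsto_const_nhds.add (tendsto_const_div_atTop_nhds_zero_nat c)).pow d
  rw [add_zero, one_pow] at h1
  refine h1.congr' ?_
  filter_upwards [eventually_gt_atTop 0] with n hn
  have : (n : ℝ) ≠ 0 := by positivity
  rw [← div_pow, add_div, div_self this]

lemma pow_le_factorial_mul_choose (n d : ℕ) :
    (n + 1) ^ d ≤ d.factorial * (n + d).choose d := by
  rw [← Nat.ascFactorial_eq_factorial_mul_choose]
  exact Nat.pow_succ_le_ascFactorial _ _

lemma factorial_mul_choose_le_pow (n d : ℕ) :
    d.factorial * (n + d).choose d ≤ (n + d) ^ d := by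
  rw [← Nat.ascFactorial_eq_factorial_mul_choose]
  exact Nat.ascFactorial_le_pow_add _ _

/-- A sequence squeezed between two shifted multiples of the polynomial `n ↦ (n + d).choose d`
has the expected leading coefficient. -/
lemma tendsto_factorial_mul_div_pow {f : ℕ → ℕ} {L d : ℕ}
    (h1 : ∀ n, (n + d).choose d * L ≤ f (n + 2)) (h2 : ∀ n, f (n + 1) ≤ (n + d).choose d * L) :
    Tendsto (fun n : ℕ => (d.factorial : ℝ) * (f n : ℝ) / (n : ℝ) ^ d) atTop (𝓝 (L : ℝ)) := by
  -- The bounds are `(n + 1)ᵈ ≤ d! · (n + d).choose d ≤ (n + d)ᵈ`. The shift `-1` arises because the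
  -- lower bound is evaluated at `n + 2`.
  have hlow := (tendsto_shift_div_pow (-1) d).mul_const (L : ℝ)
  have hupp := (tendsto_shift_div_pow d d).mul_const (L : ℝ)
  rw [one_mul] at hlow hupp
  refine tendsto_of_tendsto_of_tendsto_of_le_of_le' hlow hupp ?_ ?_
  · filter_upwards [eventually_ge_atTop 2] with n hn
    obtain ⟨n, rfl⟩ := Nat.exists_eq_add_of_le' hn
    rw [div_mul_eq_mul_div]
    refine div_le_div_of_nonneg_right ?_ (by positivity)
    have h3 : (n + 1) ^ d * L ≤ d.factorial * f (n + 2) :=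
      (Nat.mul_le_mul_right L (pow_le_factorial_mul_choose n d)).trans
        (by rw [mul_assoc]; exact Nat.mul_le_mul_left _ (h1 n))
    have h4 : ((n + 2 : ℕ) : ℝ) + -1 = (n : ℝ) + 1 := by push_cast; ring
    rw [h4]
    exact_mod_cast h3
  · filter_upwards [eventually_ge_atTop 1] with n hn
    obtain ⟨n, rfl⟩ := Nat.exists_eq_add_of_le' hn
    rw [div_mul_eq_mul_div]
    refine div_le_div_of_nonneg_right ?_ (by positivity)
    have h3 : d.factorial * f (n + 1) ≤ (n + 1 + d) ^ d * L := by
      refine (Nat.mul_le_mul_left _ (h2 n)).trans ?_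
      rw [← mul_assoc]
      refine Nat.mul_le_mul_right L ((factorial_mul_choose_le_pow n d).trans ?_)
      exact Nat.pow_le_pow_left (by omega) d
    exact_mod_cast h3

variable {R : Type u} [CommRing R] {N : Type v} [AddCommGroup N] [Module R N]

lemma length_quotient_smul_top_anti {I J : Ideal R} (h : I ≤ J) :
    Module.length R (N ⧸ J • (⊤ : Submodule R N)) ≤
      Module.length R (N ⧸ I • (⊤ : Submodule R N)) :=
  Module.length_le_of_surjective _ (Submodule.factor_surjective (Submodule.smul_mono_left h))

variable [IsLocalRing R]

lemma length_quotient_maximalIdeal_smul_top [Module.Finite R N] :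
    Module.length R (N ⧸ maximalIdeal R • (⊤ : Submodule R N)) = mu R N := by
  have h1 := IsLocalRing.spanFinrank_eq_finrank_quotient (⊤ : Submodule R N) Module.Finite.fg_top
  let e : ((⊤ : Submodule R N) ⧸ maximalIdeal R • (⊤ : Submodule R (⊤ : Submodule R N))) ≃ₗ[R]
      N ⧸ maximalIdeal R • (⊤ : Submodule R N) :=
    Submodule.Quotient.equiv _ _ Submodule.topEquiv (by
      rw [Submodule.map_smul'', Submodule.map_top]
      simp)
  rw [mu, h1, ← e.length_eq]
  let _ : Field (R ⧸ maximalIdeal R) := Ideal.Quotient.field _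
  rw [Module.length_eq_of_surjective (R := R ⧸ maximalIdeal R) Ideal.Quotient.mk_surjective,
    Module.length_eq_finrank]

variable [IsNoetherianRing R]

/-- `R ⧸ Q` is Artinian, its maximal ideal being nilpotent. Finiteness matters because `toNat` sends
an infinite length to `0`. -/
lemma length_quotient_smul_top_ne_top [Module.Finite R N] {Q : Ideal R} {k : ℕ}
    (hQ : Q ≤ maximalIdeal R) (hk : maximalIdeal R ^ k ≤ Q) :
    Module.length R (N ⧸ Q • (⊤ : Submodule R N)) ≠ ⊤ := by
  have hne : Q ≠ ⊤ := fun h => (maximalIdeal.isMaximal R).ne_top (top_le_iff.mp (h ▸ hQ))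
  have : Nontrivial (R ⧸ Q) := Ideal.Quotient.nontrivial_iff.mpr hne
  have : IsLocalRing (R ⧸ Q) := .of_surjective' _ Ideal.Quotient.mk_surjective
  have hart : IsArtinianRing (R ⧸ Q) := by
    rw [isArtinianRing_iff_isNilpotent_maximalIdeal]
    refine ⟨k, ?_⟩
    have hmax : (maximalIdeal (R ⧸ Q)).comap (Ideal.Quotient.mk Q) = maximalIdeal R :=
      eq_maximalIdeal (Ideal.comap_isMaximal_of_surjective _ Ideal.Quotient.mk_surjective)
    rw [← Ideal.map_comap_of_surjective _ Ideal.Quotient.mk_surjective (maximalIdeal (R ⧸ Q)), hmax,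
      ← Ideal.map_pow, Ideal.zero_eq_bot, Ideal.map_eq_bot_iff_le_ker, Ideal.mk_ker]
    exact hk
  have : Module.Finite (R ⧸ Q) (N ⧸ Q • (⊤ : Submodule R N)) := .of_restrictScalars_finite R _ _
  rw [Module.length_eq_of_surjective (R := R ⧸ Q) Ideal.Quotient.mk_surjective]
  exact Module.length_ne_top

/-- If `𝔪² = Q 𝔪` and `Q` is generated by a regular sequence of length `dim R` on `N`, then the
multiplicity of `N` is the length of `N / Q N`. -/
lemma hasMultiplicity_length_quotient [Module.Finite R N] {xs : List R} (hlen : xs.length = dim R)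
    (hxs : ∀ x ∈ xs, x ∈ maximalIdeal R) (h : IsWeaklyRegular N xs)
    (hm : maximalIdeal R ^ 2 = Ideal.ofList xs * maximalIdeal R) :
    HasMultiplicity R N
      (Module.length R (N ⧸ Ideal.ofList xs • (⊤ : Submodule R N))).toNat := by
  set Q := Ideal.ofList xs with hQ
  have hQm : Q ≤ maximalIdeal R := Ideal.span_le.mpr hxs
  have hmQ : ∀ n, maximalIdeal R ^ (n + 1) ≤ Q ^ n := by
    intro n
    suffices maximalIdeal R ^ (n + 1) = Q ^ n * maximalIdeal R from this ▸ Ideal.mul_le_left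
    induction n with
    | zero => simp
    | succ n ih => rw [pow_succ, ih, mul_assoc, ← sq, hm, ← mul_assoc, ← pow_succ]
  have hfin : Module.length R (N ⧸ Q • (⊤ : Submodule R N)) ≠ ⊤ :=
    length_quotient_smul_top_ne_top hQm (by simpa using hmQ 1)
  have hfin' : ∀ n, Module.length R (N ⧸ maximalIdeal R ^ n • (⊤ : Submodule R N)) ≠ ⊤ := by
    intro n
    cases n with
    | zero => simp
    | succ n =>
      exact length_quotient_smul_top_ne_top (Ideal.pow_le_self n.succ_ne_zero) le_rfl
  have hHS := length_quotient_pow_smul_top hxs h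
  rw [← hQ, hlen] at hHS
  obtain ⟨L, hL⟩ := ENat.ne_top_iff_exists.mp hfin
  rw [← hL] at hHS ⊢
  refine tendsto_factorial_mul_div_pow (fun n => ?_) fun n => ?_
  -- The offset `n + 2` in the lower bound comes from `𝔪ⁿ⁺² ≤ Qⁿ⁺¹`.
  · have h1 := length_quotient_smul_top_anti (N := N) (hmQ (n + 1))
    rw [hHS] at h1
    rw [ENat.toNat_natCast, ← Nat.cast_le (α := ℕ∞), ENat.natCast_toNat (hfin' _)]
    exact_mod_cast h1
  · have h1 := length_quotient_smul_top_anti (N := N) (Ideal.pow_right_mono hQm (n + 1))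
    rw [hHS] at h1
    rw [ENat.toNat_natCast, ← Nat.cast_le (α := ℕ∞), ENat.natCast_toNat (hfin' _)]
    exact_mod_cast h1

/-- Uniqueness of the limit gives `ℓ(N/𝔪N) = μ(N) = ℓ(N/QN)`, and a surjection `N/QN → N/𝔪N` between
modules of equal finite length is injective. -/
lemma IsUlrich.smul_top_eq (h : IsUlrich R N) {xs : List R} (hlen : xs.length = dim R)
    (hrad : (Ideal.ofList xs).radical = maximalIdeal R)
    (hm : maximalIdeal R ^ 2 = Ideal.ofList xs * maximalIdeal R) :
    maximalIdeal R • (⊤ : Submodule R N) = Ideal.ofList xs • ⊤ := by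
  have := h.isCohenMacaulay.finite
  have hQm : Ideal.ofList xs ≤ maximalIdeal R := hrad ▸ Ideal.le_radical
  have hxs : ∀ x ∈ xs, x ∈ maximalIdeal R := fun x hx => hQm (Ideal.subset_span hx)
  have h1 := hasMultiplicity_length_quotient hlen hxs
    (h.isCohenMacaulay.isWeaklyRegular hlen hrad) hm
  have h2 := tendsto_nhds_unique h.hasMultiplicity h1
  have hfin : Module.length R (N ⧸ Ideal.ofList xs • (⊤ : Submodule R N)) ≠ ⊤ :=
    length_quotient_smul_top_ne_top (k := 2) hQm (hm ▸ Ideal.mul_le_left)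
  have h3 : Module.length R (N ⧸ maximalIdeal R • (⊤ : Submodule R N)) =
      Module.length R (N ⧸ Ideal.ofList xs • (⊤ : Submodule R N)) := by
    rw [length_quotient_maximalIdeal_smul_top, Nat.cast_injective h2, ENat.natCast_toNat hfin]
  have hle : Ideal.ofList xs • (⊤ : Submodule R N) ≤ maximalIdeal R • ⊤ :=
    Submodule.smul_mono_left hQm
  have h4 := Module.length_eq_add_of_exact (LinearMap.ker (Submodule.factor hle)).subtype
    (Submodule.factor hle) Subtype.val_injective (Submodule.factor_surjective hle)
    (LinearMap.exact_subtype_ker_map _)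
  rw [h3] at h4
  have h5 : Module.length R (LinearMap.ker (Submodule.factor hle)) = 0 := by
    have h6 := h4.symm
    nth_rw 2 [← zero_add (Module.length R (N ⧸ Ideal.ofList xs • (⊤ : Submodule R N)))] at h6
    exact (ENat.add_left_injective_of_ne_top hfin) h6
  rw [Module.length_eq_zero_iff, Submodule.subsingleton_iff_eq_bot] at h5
  refine le_antisymm (fun z hz => ?_) hle
  have h6 : (Submodule.Quotient.mk z : N ⧸ Ideal.ofList xs • (⊤ : Submodule R N)) ∈
      LinearMap.ker (Submodule.factor hle) := by
    rw [LinearMap.mem_ker]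
    exact (Submodule.Quotient.mk_eq_zero _).mpr hz
  rw [h5, Submodule.mem_bot] at h6
  exact (Submodule.Quotient.mk_eq_zero _).mp h6

/-- A Cohen--Macaulay module with `𝔪 N = Q N` is Ulrich. -/
lemma isUlrich_of_smul_top_eq [Module.Finite R N] {xs : List R} (hlen : xs.length = dim R)
    (hxs : ∀ x ∈ xs, x ∈ maximalIdeal R) (h : IsWeaklyRegular N xs)
    (hm : maximalIdeal R ^ 2 = Ideal.ofList xs * maximalIdeal R)
    (hN : maximalIdeal R • (⊤ : Submodule R N) = Ideal.ofList xs • ⊤) : IsUlrich R N := by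
  refine ⟨isCohenMacaulay_of_isWeaklyRegular hlen hxs h, ?_⟩
  have h1 := hasMultiplicity_length_quotient hlen hxs h hm
  rwa [← (Submodule.quotEquivOfEq _ _ hN).length_eq, length_quotient_maximalIdeal_smul_top,
    ENat.toNat_natCast] at h1

end Multiplicity

/-! ### Regular sequences in short exact sequences -/

section ShortExact

variable {R : Type*} [CommRing R] {A B C : Type*} [AddCommGroup A] [AddCommGroup B]
  [AddCommGroup C] [Module R A] [Module R B] [Module R C]

/-- The obstruction to injectivity is the `x`-torsion of `C`, which is zero. -/
lemma quotSMulTop_map_injective {f : A →ₗ[R] B} {g : B →ₗ[R] C} (hf : Function.Injective f)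
    (hfg : Function.Exact f g) {x : R} (hx : IsSMulRegular C x) :
    Function.Injective (QuotSMulTop.map x f) := by
  rw [← LinearMap.ker_eq_bot, LinearMap.ker_eq_bot']
  intro z hz
  obtain ⟨z, rfl⟩ := Submodule.Quotient.mk_surjective _ z
  rw [QuotSMulTop.map_apply_mk, Submodule.Quotient.mk_eq_zero] at hz
  obtain ⟨b, -, hb⟩ := (Submodule.mem_smul_pointwise_iff_exists _ _ _).mp hz
  have hgb : g b = 0 := hx.right_eq_zero_of_smul (by
    rw [← map_smul, hb]
    exact hfg.apply_apply_eq_zero z)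
  obtain ⟨a, rfl⟩ := (hfg b).mp hgb
  rw [← map_smul] at hb
  rw [Submodule.Quotient.mk_eq_zero, ← hf hb]
  exact Submodule.smul_mem_pointwise_smul _ _ _ trivial

end ShortExact

section WeaklyRegular

variable {R : Type*} [CommRing R]

/-- In a short exact sequence, regularity of the middle and right terms passes to the left. -/
lemma isWeaklyRegular_left_of_exact {l : List R} :
    ∀ {A : Type u} {B : Type v} {C : Type w} [AddCommGroup A] [AddCommGroup B] [AddCommGroup C]
      [Module R A] [Module R B] [Module R C] {f : A →ₗ[R] B} {g : B →ₗ[R] C}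
      (_ : Function.Injective f) (_ : Function.Exact f g) (_ : Function.Surjective g)
      (_ : IsWeaklyRegular B l) (_ : IsWeaklyRegular C l), IsWeaklyRegular A l := by
  induction l with
  | nil => intros; exact .nil _ _
  | cons x l ih =>
    intro A B C _ _ _ _ _ _ f g hf hfg hg hB hC
    rw [isWeaklyRegular_cons_iff] at hB hC ⊢
    exact ⟨hB.1.of_injective f hf, ih (quotSMulTop_map_injective hf hfg hC.1)
      (QuotSMulTop.map_exact x hfg hg) (QuotSMulTop.map_surjective x hg) hB.2 hC.2⟩

/-- In a short exact sequence, regularity of the outer terms passes to the middle. -/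
lemma isWeaklyRegular_middle_of_exact {l : List R} :
    ∀ {A : Type u} {B : Type v} {C : Type w} [AddCommGroup A] [AddCommGroup B] [AddCommGroup C]
      [Module R A] [Module R B] [Module R C] {f : A →ₗ[R] B} {g : B →ₗ[R] C}
      (_ : Function.Injective f) (_ : Function.Exact f g) (_ : Function.Surjective g)
      (_ : IsWeaklyRegular A l) (_ : IsWeaklyRegular C l), IsWeaklyRegular B l := by
  induction l with
  | nil => intros; exact .nil _ _
  | cons x l ih =>
    intro A B C _ _ _ _ _ _ f g hf hfg hg hA hC
    rw [isWeaklyRegular_cons_iff] at hA hC ⊢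
    exact ⟨isSMulRegular_of_range_eq_ker hf hfg.linearMap_ker_eq.symm hA.1 hC.1,
      ih (quotSMulTop_map_injective hf hfg hC.1) (QuotSMulTop.map_exact x hfg hg)
        (QuotSMulTop.map_surjective x hg) hA.2 hC.2⟩

/-- Tensoring with the flat module `Rⁿ` preserves weak regularity. -/
lemma isWeaklyRegular_pi {l : List R} (h : IsWeaklyRegular R l) (n : ℕ) :
    IsWeaklyRegular (Fin n → R) l :=
  ((TensorProduct.rid R (Fin n → R)).isWeaklyRegular_congr l).mp
    (h.isWeaklyRegular_lTensor (M₂ := Fin n → R))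

/-- If `l` is regular on the image of a surjection `P : B → C`, then
`(l) B ∩ ker P ⊆ (l) ker P`. -/
lemma smul_top_inf_ker_le {B C : Type*} [AddCommGroup B] [AddCommGroup C] [Module R B]
    [Module R C] {P : B →ₗ[R] C} (hP : Function.Surjective P) {l : List R}
    (h : IsWeaklyRegular C l) :
    Ideal.ofList l • (⊤ : Submodule R B) ⊓ LinearMap.ker P ≤ Ideal.ofList l • LinearMap.ker P := by
  rintro z ⟨hzl, hz⟩
  -- A zero module on the left turns the short exact sequence into a four-term one; exactness modulo
  -- `(l)` then says that `ker P/(l)ker P → B/(l)B` is injective.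
  have h0 : Function.Exact (0 : PUnit →ₗ[R] LinearMap.ker P) (LinearMap.ker P).subtype := by
    intro y
    constructor
    · intro hy
      exact ⟨0, Subtype.ext hy.symm⟩
    · rintro ⟨_, rfl⟩
      simp
  have hex := map_first_exact_on_four_term_right_exact_of_isSMulRegular_last h0
    (LinearMap.exact_subtype_ker_map P) hP h
  obtain ⟨y, hy⟩ := (hex (Submodule.Quotient.mk ⟨z, hz⟩)).mp
    ((Submodule.Quotient.mk_eq_zero _).mpr hzl)
  obtain ⟨y, rfl⟩ := Submodule.Quotient.mk_surjective _ y
  have hmem := (Submodule.Quotient.mk_eq_zero _).mp hy.symm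
  have hmap : Ideal.ofList l • LinearMap.ker P =
      (Ideal.ofList l • (⊤ : Submodule R (LinearMap.ker P))).map (LinearMap.ker P).subtype := by
    rw [Submodule.map_smul'', Submodule.map_top, Submodule.range_subtype]
  rw [hmap]
  exact ⟨⟨z, hz⟩, hmem, rfl⟩

end WeaklyRegular

/-! ### The syzygy as the preimage of `aM` -/

section Syzygy

variable {R : Type u} [CommRing R] {F M : Type*} [AddCommGroup F] [Module R F] [AddCommGroup M]
  [Module R M] {P : F →ₗ[R] M} {a : R}

/-- The preimage of `a M` under a surjection `P : F → M` is `ker P + a F`. -/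
lemma mem_comap_smul_top_iff (hP : Function.Surjective P) {z : F} :
    z ∈ (a • (⊤ : Submodule R M)).comap P ↔ ∃ b : F, z - a • b ∈ LinearMap.ker P := by
  rw [Submodule.mem_comap, Submodule.mem_smul_pointwise_iff_exists]
  constructor
  · rintro ⟨m, -, hm⟩
    obtain ⟨b, rfl⟩ := hP m
    exact ⟨b, by simp [hm]⟩
  · rintro ⟨b, hb⟩
    refine ⟨P b, trivial, ?_⟩
    rw [LinearMap.mem_ker, map_sub, map_smul, sub_eq_zero] at hb
    exact hb.symm

/-- The key computation: if `𝔪 M = Q M`, `𝔪 ker P ⊆ Q ker P` and `a ∈ Q`, then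
`𝔪 Z = Q Z` for `Z = P⁻¹(a M)`. -/
lemma smul_comap_smul_top_le (hP : Function.Surjective P) {m Q : Ideal R} (haQ : a ∈ Q)
    (hM : m • (⊤ : Submodule R M) ≤ Q • ⊤) (hK : m • LinearMap.ker P ≤ Q • LinearMap.ker P) :
    m • (a • (⊤ : Submodule R M)).comap P ≤ Q • (a • (⊤ : Submodule R M)).comap P := by
  set Z := (a • (⊤ : Submodule R M)).comap P
  have hKZ : LinearMap.ker P ≤ Z := fun z hz =>
    (mem_comap_smul_top_iff hP).mpr ⟨0, by simpa using hz⟩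
  have haZ : ∀ b : F, a • b ∈ Z := fun b => (mem_comap_smul_top_iff hP).mpr ⟨b, by simp⟩
  have haQZ : ∀ c ∈ Q • (⊤ : Submodule R F), a • c ∈ Q • Z := by
    intro c hc
    have h1 : a • c ∈ (Q • (⊤ : Submodule R F)).map (LinearMap.lsmul R F a) := ⟨c, hc, rfl⟩
    rw [Submodule.map_smul''] at h1
    refine Submodule.smul_mono le_rfl ?_ h1
    rintro _ ⟨b, -, rfl⟩
    exact haZ b
  rw [Submodule.smul_le]
  intro r hr z hz
  obtain ⟨b, hb⟩ := (mem_comap_smul_top_iff hP).mp hz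
  have h1 : r • (z - a • b) ∈ Q • Z :=
    Submodule.smul_mono le_rfl hKZ (hK (Submodule.smul_mem_smul hr hb))
  -- Since `𝔪M ⊆ QM`, the element `rb` agrees modulo `ker P` with some `c ∈ QF`. In the splitting
  -- `h4`, `a(rb - c)` lies in `Q ker P` because `a ∈ Q`, and `ac` lies in `Q(aF)`.
  have h2 : P (r • b) ∈ (Q • (⊤ : Submodule R F)).map P := by
    rw [Submodule.map_smul'', Submodule.map_top, LinearMap.range_eq_top.mpr hP, map_smul]
    exact hM (Submodule.smul_mem_smul hr trivial)
  obtain ⟨c, hc, hcb⟩ := h2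
  have h3 : a • (r • b - c) ∈ Q • Z :=
    Submodule.smul_mem_smul haQ (hKZ (by rw [LinearMap.mem_ker, map_sub, hcb, sub_self]))
  have h4 : r • z = r • (z - a • b) + (a • (r • b - c) + a • c) := by
    rw [smul_sub, smul_sub, smul_comm r a b]
    abel
  rw [h4]
  exact Submodule.add_mem _ h1 (Submodule.add_mem _ h3 (haQZ c hc))

/-- Regularity of the preimage of `a M` under a surjection `P : F → M`. -/
lemma isWeaklyRegular_comap_smul_top (hP : Function.Surjective P) (ha : IsSMulRegular M a)
    {l : List R} (hF : IsWeaklyRegular F l) (hM : IsWeaklyRegular M l) :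
    IsWeaklyRegular ((a • (⊤ : Submodule R M)).comap P) l := by
  set Z := (a • (⊤ : Submodule R M)).comap P
  have hKZ : LinearMap.ker P ≤ Z := fun z hz =>
    (mem_comap_smul_top_iff hP).mpr ⟨0, by simpa using hz⟩
  have hK : IsWeaklyRegular (LinearMap.ker P) l :=
    isWeaklyRegular_left_of_exact Subtype.val_injective (LinearMap.exact_subtype_ker_map P) hP hF hM
  -- The outer terms of `0 → ker P → Z → aM → 0` are weakly regular, as `aM ≅ M`.
  let e : M ≃ₗ[R] LinearMap.range (LinearMap.lsmul R M a) := LinearEquiv.ofInjective _ ha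
  have haM : ∀ z : Z, P z ∈ LinearMap.range (LinearMap.lsmul R M a) := by
    rintro ⟨z, hz⟩
    obtain ⟨m, -, hm⟩ := (Submodule.mem_smul_pointwise_iff_exists _ _ _).mp hz
    exact ⟨m, hm⟩
  let g : Z →ₗ[R] LinearMap.range (LinearMap.lsmul R M a) :=
    (P ∘ₗ Z.subtype).codRestrict _ haM
  refine isWeaklyRegular_middle_of_exact (f := Submodule.inclusion hKZ) (g := g)
    (Submodule.inclusion_injective hKZ) (fun z => ?_) ?_ hK ((e.isWeaklyRegular_congr l).mp hM)
  · constructor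
    · intro hz
      exact ⟨⟨z, congrArg Subtype.val hz⟩, rfl⟩
    · rintro ⟨k, rfl⟩
      exact Subtype.ext k.2
  · rintro ⟨_, m, rfl⟩
    obtain ⟨b, rfl⟩ := hP m
    refine ⟨⟨a • b, (mem_comap_smul_top_iff hP).mpr ⟨b, by simp⟩⟩, Subtype.ext ?_⟩
    exact map_smul P a b

/-- A surjection from a free module onto `M / a M` lifts to a surjection onto `M`. -/
lemma exists_surjective_lift_of_quotSMulTop [IsLocalRing R] [Module.Finite R M]
    [Module.Projective R F] (ha : a ∈ maximalIdeal R) {p : F →ₗ[R] QuotSMulTop a M}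
    (hp : Function.Surjective p) :
    ∃ P : F →ₗ[R] M, Function.Surjective P ∧
      LinearMap.ker p = (a • (⊤ : Submodule R M)).comap P := by
  obtain ⟨P, rfl⟩ := Module.projective_lifting_property
    (Submodule.mkQ (a • (⊤ : Submodule R M))) p (Submodule.mkQ_surjective _)
  refine ⟨P, ?_, by rw [LinearMap.ker_comp, Submodule.ker_mkQ]⟩
  rw [← LinearMap.range_eq_top, ← top_le_iff]
  refine Submodule.le_of_le_smul_of_le_jacobson_bot (I := maximalIdeal R) Module.Finite.fg_top
    (maximalIdeal_le_jacobson _) fun m _ => ?_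
  obtain ⟨b, hb⟩ := hp (Submodule.Quotient.mk m)
  have h1 := (Submodule.Quotient.eq _).mp hb.symm
  obtain ⟨n, -, hn⟩ := (Submodule.mem_smul_pointwise_iff_exists _ _ _).mp h1
  rw [show m = P b + a • n by rw [hn]; abel]
  exact Submodule.add_mem_sup ⟨b, rfl⟩ (Submodule.smul_mem_smul ha trivial)

end Syzygy
end Ulrich

/-! ### The theorem -/

open Ulrich Pointwise in
theorem corollary2p4 {R : Type*} [CommRing R] [IsLocalRing R] [IsNoetherianRing R]
    (hR : Ulrich.IsCohenMacaulay R R)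
    (Q : Ideal R) (hQ : Ulrich.IsParameterIdeal R Q)
    (hm : IsLocalRing.maximalIdeal R ^ 2 = Q * IsLocalRing.maximalIdeal R)
    {M : Type*} [AddCommGroup M] [Module R M] (hM : Ulrich.IsUlrich R M)
    (a : R) (haQ : a ∈ Q) (ha : IsSMulRegular R a)
    {Z : Type*} [AddCommGroup Z] [Module R Z]
    (hZ : Ulrich.IsFirstSyzygy R Z (QuotSMulTop a M)) :
    Ulrich.IsUlrich R Z := by
  obtain ⟨x, rfl, hrad⟩ := hQ
  obtain ⟨n, i, p, hi, hip, hp, hmin⟩ := hZ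
  have hofList : Ideal.span (Set.range x) = Ideal.ofList (List.ofFn x) := by
    rw [Ideal.ofList]
    congr 1
    ext
    simp [List.mem_ofFn]
  have hlen : (List.ofFn x).length = dim R := List.length_ofFn
  generalize List.ofFn x = xs at hofList hlen
  rw [hofList] at hrad hm haQ
  have hQm : Ideal.ofList xs ≤ maximalIdeal R := hrad ▸ Ideal.le_radical
  have hxs : ∀ x ∈ xs, x ∈ maximalIdeal R := fun x hx => hQm (Ideal.subset_span hx)
  have := hM.isCohenMacaulay.finite
  obtain ⟨P, hP, hker⟩ := exists_surjective_lift_of_quotSMulTop (hQm haQ) hp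
  have hrange : LinearMap.range i = (a • (⊤ : Submodule R M)).comap P :=
    hip.linearMap_ker_eq.symm.trans hker
  have hMreg := hM.isCohenMacaulay.isWeaklyRegular hlen hrad
  have hZreg : RingTheory.Sequence.IsWeaklyRegular Z xs :=
    ((LinearEquiv.ofInjective i hi ≪≫ₗ LinearEquiv.ofEq _ _ hrange).isWeaklyRegular_congr xs).mpr
      (isWeaklyRegular_comap_smul_top hP (hM.isCohenMacaulay.isSMulRegular ha)
        (isWeaklyRegular_pi (hR.isWeaklyRegular hlen hrad) n) hMreg)
  have : Module.Finite R Z := Module.Finite.of_injective i hi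
  refine isUlrich_of_smul_top_eq hlen hxs hZreg hm
    (le_antisymm ?_ (Submodule.smul_mono_left hQm))
  -- Minimality of the cover enters only here, through `ker P ≤ Z ≤ 𝔪F`.
  have hK : maximalIdeal R • LinearMap.ker P ≤ Ideal.ofList xs • LinearMap.ker P := by
    refine le_trans (le_inf ?_ Submodule.smul_le_right) (smul_top_inf_ker_le hP hMreg)
    have h1 : LinearMap.ker P ≤ maximalIdeal R • (⊤ : Submodule R (Fin n → R)) := by
      refine le_trans (fun z hz => ?_) (hrange ▸ hmin)
      exact (mem_comap_smul_top_iff hP).mpr ⟨0, by simpa using hz⟩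
    refine (Submodule.smul_mono le_rfl h1).trans ?_
    rw [← Submodule.mul_smul, ← sq, hm]
    exact Submodule.smul_mono_left Ideal.mul_le_left
  have hle := smul_comap_smul_top_le hP haQ (hM.smul_top_eq hlen hrad hm).le hK
  rw [← hrange] at hle
  rw [← Submodule.map_le_map_iff_of_injective hi, Submodule.map_smul'', Submodule.map_smul'',
    Submodule.map_top]
  exact hle
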